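/- Let $d\ge 1$, let $\mathbb T^d=\mathbb R^d/\mathbb Z^d$, and let $k\in\mathbb N$ satisfy $2k>\frac d2+3$. Let $H:\mathbb R^d\to\mathbb R$, $g:[0,\infty)\to\mathbb R$ and $V,\phi:\mathbb T^d\to\mathbb R$ be functions such that (1) $H$ is convex and of class $C^2$; $g$ is non-negative, continuous and increasing (not necessarily strictly); $\phi$ is continuous, $\phi>0$ and $\int_{\mathbb T^d}\phi\,dx=1$; (2) there are constants $\alpha>1$ and $C>0$ with $-H(q)+D_pH(q)\cdot q\ge \frac1C|q|^\alpha-C$ for all $q\in\mathbb R^d$; (3) for the same $\alpha$ there is a constant $C>0$ with $H(q)\ge\frac1C|q|^\alpha-C$ for all $q\in\mathbb R^d$; (4) for each $\delta\in(0,1)$ there is a constant $C_\delta>0$ such that, for all $m\in L^1(\mathbb T^d)$ with $m\ge0$, $$\int_{\mathbb T^d}m\,dx+\int_{\mathbb T^d}g(m)\,dx\le\delta\int_{\mathbb T^d}m\,g(m)\,dx+C_\delta ,$$ where the integrals are those of non-negative functions, with values in $[0,\infty]$. Let $\epsilon\in(0,1)$ and let $p_\epsilon:(0,\infty)\to(-\infty,0]$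 be a non-decreasing $C^\infty$ function with $p_\epsilon(t)=-t^{-(d+1)}$ for $0<t\le\frac\epsilon2$ and $p_\epsilon(t)=0$ for $t\ge\epsilon$. For $\lambda\in[0,1]$ consider the system $$\begin{cases}-u-\lambda H(Du)+\lambda g(m)-\lambda V+p_\epsilon(m)+\epsilon\,(m+\Delta^{2k}m)=0,\\ m-\lambda\,\mathrm{div}\big(m\,D_pH(Du)\big)-\lambda\phi-(1-\lambda)+\epsilon\,(u+\Delta^{2k}u)=0\end{cases}\qquad\text{in }\mathbb T^d,\tag{$P_\lambda$}$$ and let $\Lambda$ be the set of all $\lambda\in[0,1]$ for which $(P_\lambda)$ has a solution $(m,u)\in C^\infty(\mathbb T^d)\times C^\infty(\mathbb T^d)$ with $\min_{\mathbb T^d}m>0$. Then there is a constant $c>0$ (which may depend on $d,k,H,g,V,\phi,\epsilon,p_\epsilon$, but not on $\lambda$, on the solution or on $x$) such that, for every $\lambda\in\Lambda$ and every solution $(m_\lambda,u_\lambda)\in C^\infty(\mathbb T^d)\times C^\infty(\mathbb T^d)$ of $(P_\lambda)$ with $\min_{\mathbb T^d}m_\lambda>0$, $$m_\lambda(x)\ge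 c\qquad\text{for all }x\in\mathbb T^d .$$ -/

import Mathlib

open MeasureTheory Set
open scoped ContDiff ENNReal

noncomputable section

namespace MFG

/-- The Euclidean space `ℝ^d`, the universal cover of the torus. -/
abbrev E (d : ℕ) := EuclideanSpace ℝ (Fin d)

/-- The `d`-dimensional torus `𝕋^d = ℝ^d / ℤ^d`, with its Haar probability measure `volume`. -/
abbrev Torus (d : ℕ) := UnitAddTorus (Fin d)

variable {d : ℕ}

/-- The quotient map `ℝ^d → 𝕋^d`. -/
def proj (x : E d) : Torus d := fun i => (x i : UnitAddCircle)

/-- The `ℤ^d`-periodic function on `ℝ^d` that corresponds to a function on `𝕋^d`. Derivatives of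
functions on the torus are those of their periodic lifts. -/
def lift (f : Torus d → ℝ) (x : E d) : ℝ := f (proj x)

/-- `f ∈ C^∞(𝕋^d)`. -/
def Smooth (f : Torus d → ℝ) : Prop := ContDiff ℝ ∞ (lift f)

/-- The divergence `∑ i, ∂ᵢ Xᵢ` of a vector field on `ℝ^d`. -/
def divergence (X : E d → E d) (x : E d) : ℝ :=
  ∑ i, (fderiv ℝ X x (EuclideanSpace.single i 1)) i

/-- The `j`-th power `Δ^j` of the Laplacian on `ℝ^d`. -/
def laplacianPow (j : ℕ) (f : E d → ℝ) : E d → ℝ :=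
  (fun h : E d → ℝ => Laplacian.laplacian h)^[j] f

/-- `p` is a penalty with parameter `ε` on `(0, ∞)` (its values on `(-∞, 0]` are irrelevant):
a non-decreasing smooth function `(0, ∞) → (-∞, 0]`, equal to `-1 / t^(d+1)` on `(0, ε/2]` and to
`0` on `[ε, ∞)`. -/
structure IsPenalty (d : ℕ) (ε : ℝ) (p : ℝ → ℝ) : Prop where
  smooth : ContDiffOn ℝ ∞ p (Ioi 0)
  mono : MonotoneOn p (Ioi 0)
  nonpos : ∀ t, 0 < t → p t ≤ 0
  eq_near_zero : ∀ t, 0 < t → t ≤ ε / 2 → p t = -(1 / t ^ (d + 1))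
  eq_zero : ∀ t, ε ≤ t → p t = 0

/-- First component of the operator `F_ε^λ`:
`-u - λ H(Du) + λ g(m) - λ V + p_ε(m) + ε (m + Δ^{2k} m)`. -/
def opHJ (k : ℕ) (H : E d → ℝ) (g : ℝ → ℝ) (V : Torus d → ℝ) (ε : ℝ) (p : ℝ → ℝ) (lam : ℝ)
    (m u : Torus d → ℝ) (x : E d) : ℝ :=
  -lift u x - lam * H (gradient (lift u) x) + lam * g (lift m x) - lam * lift V x + p (lift m x)
    + ε * (lift m x + laplacianPow (2 * k) (lift m) x)

/-- Second component of the operator `F_ε^λ`: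
`m - λ div(m D_pH(Du)) - λ φ - (1 - λ) + ε (u + Δ^{2k} u)`. -/
def opFP (k : ℕ) (H : E d → ℝ) (φ : Torus d → ℝ) (ε : ℝ) (lam : ℝ)
    (m u : Torus d → ℝ) (x : E d) : ℝ :=
  lift m x - lam * divergence (fun y => lift m y • gradient H (gradient (lift u) y)) x
    - lam * lift φ x - (1 - lam) + ε * (lift u x + laplacianPow (2 * k) (lift u) x)

/-- `(m, u)` is a smooth solution of `F_ε^λ (m, u) = (0, 0)` on `𝕋^d` with `m > 0`
(equivalently `min m > 0`, as the torus is compact). -/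
structure IsSmoothSolution (k : ℕ) (H : E d → ℝ) (g : ℝ → ℝ) (V φ : Torus d → ℝ) (ε : ℝ)
    (p : ℝ → ℝ) (lam : ℝ) (m u : Torus d → ℝ) : Prop where
  smooth_m : Smooth m
  smooth_u : Smooth u
  pos : ∀ x, 0 < m x
  hj : ∀ x, opHJ k H g V ε p lam m u x = 0
  fp : ∀ x, opFP k H φ ε lam m u x = 0

/-- The set `Λ` of all `λ ∈ [0, 1]` for which `F_ε^λ (m, u) = (0, 0)` has a smooth solution with
`min m > 0`. -/
def pathSet (k : ℕ) (H : E d → ℝ) (g : ℝ → ℝ) (V φ : Torus d → ℝ) (ε : ℝ) (p : ℝ → ℝ) : Set ℝ :=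
  {lam | lam ∈ Icc (0 : ℝ) 1 ∧
    ∃ m u : Torus d → ℝ, IsSmoothSolution k H g V φ ε p lam m u}

end MFG

end

/-! Multiply the first equation by `m - 1`, the second by `u`, add and integrate. The products `m *
u` cancel, and integration by parts turns the divergence into `λ m D_pH(Du)·Du` and `Δ^{2k}` into
squares of `Δ^k`. Since `H` and `D_pH·q - H` are bounded below and `(m - 1) g(m) ≥ -g(1)`, the terms
linear in `m` and `u` are absorbed by `ε m²` and `ε u²`. The penalty has the good sign: `p(m) (m -
1) ≥ (1 - ε) (-p(m))`. Hence `∫ -p(m)` and `∫ (Δ^k m)²` are bounded uniformly in `λ`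
(`exists_energy_bound`).

As `4k > d + 2`, the second bound gives a Lipschitz constant `L` for `m`
(`exists_dist_le_of_laplacianPow`). If `m` took a small value `η`, then `m ≤ 2η` on a ball of radius
`η / L`, whose volume is of order `η^d`, while there `-p(m) ≥ (2η)^{-(d+1)}`. So `∫ -p(m)` would be
at least of order `1 / η`, which bounds `η` from below (`le_of_penalty_bound`). -/

noncomputable section

namespace MFG

variable {d : ℕ}

/-! ### Periodic functions on `ℝ^d` and functions on the torus. -/

section Periodic

lemma proj_add (x y : E d) : proj (x + y) = proj x + proj y := by
  ext i; simp [proj]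

lemma proj_sub (x y : E d) : proj (x - y) = proj x - proj y := by
  ext i; simp [proj]

lemma isOpenQuotientMap_proj : IsOpenQuotientMap (proj : E d → Torus d) := by
  have h1 : IsOpenQuotientMap (Pi.map (fun (_ : Fin d) (t : ℝ) => (t : UnitAddCircle))) :=
    IsOpenQuotientMap.piMap fun _ => QuotientAddGroup.isOpenQuotientMap_mk
  exact h1.comp (EuclideanSpace.equiv (Fin d) ℝ).toHomeomorph.isOpenQuotientMap

lemma continuous_proj : Continuous (proj : E d → Torus d) := isOpenQuotientMap_proj.continuous

/-- A right inverse of the projection `ℝ^d → 𝕋^d`. -/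
def rep (x : Torus d) : E d := Function.surjInv isOpenQuotientMap_proj.surjective x

@[simp]
lemma proj_rep (x : Torus d) : proj (rep x) = x :=
  Function.surjInv_eq isOpenQuotientMap_proj.surjective x

@[simp]
lemma lift_rep (f : Torus d → ℝ) (x : Torus d) : lift f (rep x) = f x := by simp [lift]

/-- `F` is `ℤ^d`-periodic. -/
def TorusPeriodic {G : Type*} (F : E d → G) : Prop := ∀ x y, proj x = proj y → F x = F y

lemma torusPeriodic_lift (f : Torus d → ℝ) : TorusPeriodic (lift f) := fun x y h => by
  simp [lift, h]

namespace TorusPeriodic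

variable {G : Type*} {F : E d → G}

lemma comp (hF : TorusPeriodic F) {G' : Type*} (φ : G → G') :
    TorusPeriodic fun x => φ (F x) := fun x y h => congrArg φ (hF x y h)

lemma comp₂ (hF : TorusPeriodic F) {G₁ G₂ : Type*} {F₁ : E d → G₁} (hF₁ : TorusPeriodic F₁)
    (φ : G → G₁ → G₂) : TorusPeriodic fun x => φ (F x) (F₁ x) :=
  fun x y h => by simp only [hF x y h, hF₁ x y h]

lemma apply_rep_proj (hF : TorusPeriodic F) (x : E d) : F (rep (proj x)) = F x :=
  hF _ _ (proj_rep _)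

lemma add_right (hF : TorusPeriodic F) (v : E d) : TorusPeriodic fun x => F (x + v) :=
  fun x y h => hF _ _ (by rw [proj_add, proj_add, h])

lemma add_sub (hF : TorusPeriodic F) {x y : E d} (h : proj x = proj y) :
    (fun z => F (z + (y - x))) = F := by
  ext z
  exact hF _ _ (by rw [proj_add, proj_sub, h, sub_self, add_zero])

/-- The section `rep` need not be continuous; continuity descends because `proj` is a quotient map
and the pullback of this function along it is `F`. -/
lemma continuous_comp_rep [TopologicalSpace G] (hF : TorusPeriodic F) (hc : Continuous F) :
    Continuous fun x : Torus d => F (rep x) := by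
  refine isOpenQuotientMap_proj.isQuotientMap.continuous_iff.2 ?_
  convert hc using 1
  ext x
  exact hF.apply_rep_proj x

lemma exists_norm_le [SeminormedAddCommGroup G] (hF : TorusPeriodic F) (hc : Continuous F) :
    ∃ C, ∀ x, ‖F x‖ ≤ C := by
  obtain ⟨C, hC⟩ := isCompact_univ.exists_bound_of_continuousOn
    (hF.continuous_comp_rep hc).continuousOn
  exact ⟨C, fun x => by simpa [hF.apply_rep_proj] using hC (proj x) (mem_univ _)⟩

variable [NormedAddCommGroup G] [NormedSpace ℝ G]

lemma fderiv (hF : TorusPeriodic F) : TorusPeriodic (fderiv ℝ F) := fun x y h => by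
  have := fderiv_comp_add_right (𝕜 := ℝ) (f := F) (x := x) (y - x)
  rwa [hF.add_sub h, add_sub_cancel] at this

lemma fderiv_apply (hF : TorusPeriodic F) (v : E d) :
    TorusPeriodic fun x => _root_.fderiv ℝ F x v := hF.fderiv.comp (· v)

lemma laplacian (hF : TorusPeriodic F) : TorusPeriodic (Laplacian.laplacian F) := fun x y h => by
  have := hF.fderiv.fderiv x y h
  simp only [InnerProductSpace.laplacian_eq_iteratedFDeriv_stdOrthonormalBasis,
    iteratedFDeriv_two_apply, this]

lemma gradient {F : E d → ℝ} (hF : TorusPeriodic F) : TorusPeriodic (gradient F) :=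
  hF.fderiv.comp (InnerProductSpace.toDual ℝ (E d)).symm

end TorusPeriodic

end Periodic

/-! ### Means over the torus; a derivative has mean zero. -/

section Average

/-- The Haar probability measure of the torus. -/
def torusMeasure (d : ℕ) : Measure (Torus d) := Measure.pi fun _ => AddCircle.haarAddCircle

instance : IsProbabilityMeasure (torusMeasure d) :=
  inferInstanceAs (IsProbabilityMeasure (Measure.pi fun _ => AddCircle.haarAddCircle))

instance : (torusMeasure d).IsAddHaarMeasure :=
  inferInstanceAs (Measure.IsAddHaarMeasure (Measure.pi fun _ => AddCircle.haarAddCircle))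

variable {G : Type*} [NormedAddCommGroup G] [NormedSpace ℝ G] {F F₁ : E d → G}

lemma _root_.ContDiff.continuous_fderiv_const_apply (hF : ContDiff ℝ 1 F) (v : E d) :
    Continuous fun x => fderiv ℝ F x v :=
  (hF.continuous_fderiv one_ne_zero).clm_apply continuous_const

/-- The mean over the torus of a periodic function. -/
def torusAvg (F : E d → G) : G := ∫ x, F (rep x) ∂torusMeasure d

lemma integrable_of_continuous {G : Type*} [NormedAddCommGroup G] {f : Torus d → G} (hf : Continuous f) :
    Integrable f (torusMeasure d) :=
  hf.integrable_of_hasCompactSupport (HasCompactSupport.of_compactSpace f)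

lemma TorusPeriodic.integrable {G : Type*} [NormedAddCommGroup G] {F : E d → G} (hF : TorusPeriodic F) (hc : Continuous F) :
    Integrable (fun x => F (rep x)) (torusMeasure d) :=
  integrable_of_continuous (hF.continuous_comp_rep hc)

lemma torusAvg_add (hF : TorusPeriodic F) (hc : Continuous F) (hF₁ : TorusPeriodic F₁)
    (hc₁ : Continuous F₁) : torusAvg (fun x => F x + F₁ x) = torusAvg F + torusAvg F₁ :=
  integral_add (hF.integrable hc) (hF₁.integrable hc₁)

lemma torusAvg_sub (hF : TorusPeriodic F) (hc : Continuous F) (hF₁ : TorusPeriodic F₁)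
    (hc₁ : Continuous F₁) : torusAvg (fun x => F x - F₁ x) = torusAvg F - torusAvg F₁ :=
  integral_sub (hF.integrable hc) (hF₁.integrable hc₁)

lemma torusAvg_sum {ι : Type*} (s : Finset ι) {F : ι → E d → G} (hF : ∀ i, TorusPeriodic (F i))
    (hc : ∀ i, Continuous (F i)) :
    torusAvg (fun x => ∑ i ∈ s, F i x) = ∑ i ∈ s, torusAvg (F i) :=
  integral_finsetSum s fun i _ => (hF i).integrable (hc i)

lemma torusAvg_add_right (hF : TorusPeriodic F) (v : E d) :
    torusAvg (fun x => F (x + v)) = torusAvg F := by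
  have : ∀ x, F (rep x + v) = F (rep (x + proj v)) := fun x => hF _ _ (by simp [proj_add])
  simp only [torusAvg, this]
  exact integral_add_right_eq_self (fun x => F (rep x)) (proj v)

/-- By translation invariance the mean of `F (x + t • v)` does not depend on `t`; differentiate
under the integral at `t = 0`. Every integration by parts below rests on this. -/
lemma torusAvg_fderiv_eq_zero [CompleteSpace G] (hF : TorusPeriodic F) (hc : ContDiff ℝ 1 F)
    (v : E d) : torusAvg (fun x => fderiv ℝ F x v) = 0 := by
  have hcont : Continuous fun x => fderiv ℝ F x v := hc.continuous_fderiv_const_apply v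
  obtain ⟨C, hC⟩ := (hF.fderiv_apply v).exists_norm_le hcont
  have hder : ∀ (x : E d) (t : ℝ),
      HasDerivAt (fun t : ℝ => F (x + t • v)) (fderiv ℝ F (x + t • v) v) t := by
    intro x t
    have h1 : HasDerivAt (fun t : ℝ => x + t • v) v t := by
      simpa using ((hasDerivAt_id t).smul_const v).const_add x
    exact ((hc.differentiable one_ne_zero _).hasFDerivAt).comp_hasDerivAt t h1
  have key := (hasDerivAt_integral_of_dominated_loc_of_deriv_le (μ := torusMeasure d)
    (F := fun (t : ℝ) x => F (rep x + t • v)) (F' := fun t x => fderiv ℝ F (rep x + t • v) v)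
    (x₀ := (0 : ℝ)) (bound := fun _ => C) (s := univ) Filter.univ_mem
    (.of_forall fun t => ((hF.add_right (t • v)).integrable
      (hc.continuous.comp (continuous_add_const _))).aestronglyMeasurable)
    ((hF.add_right _).integrable (hc.continuous.comp (continuous_add_const _)))
    (((hF.fderiv_apply v).add_right ((0 : ℝ) • v)).integrable
      (hcont.comp (continuous_add_const _))).aestronglyMeasurable
    (.of_forall fun x t _ => hC _) (integrable_const C)
    (.of_forall fun x t _ => hder _ _)).2
  have hconst : (fun t : ℝ => ∫ x, F (rep x + t • v) ∂torusMeasure d) = fun _ => torusAvg F := by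
    ext t
    exact torusAvg_add_right hF (t • v)
  rw [hconst] at key
  simpa [torusAvg] using key.unique (hasDerivAt_const _ _)

end Average

/-! ### Green's identities for powers of the Laplacian and for the divergence. -/

section Green

variable {𝕜 : Type*} [RCLike 𝕜] {f g : E d → 𝕜}

lemma _root_.ContDiff.laplacian_apply {G : Type*} [NormedAddCommGroup G] [NormedSpace ℝ G]
    {f : E d → G} (hf : ContDiff ℝ 2 f) (x : E d) :
    Laplacian.laplacian f x = ∑ i, fderiv ℝ
      (fun y => fderiv ℝ f y (EuclideanSpace.basisFun (Fin d) ℝ i)) x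
      (EuclideanSpace.basisFun (Fin d) ℝ i) := by
  rw [InnerProductSpace.laplacian_eq_iteratedFDeriv_orthonormalBasis f
    (EuclideanSpace.basisFun (Fin d) ℝ)]
  refine Finset.sum_congr rfl fun i _ => ?_
  have h1 : DifferentiableAt ℝ (fderiv ℝ f) x :=
    (hf.fderiv_right (m := 1) le_rfl).differentiable one_ne_zero x
  rw [fderiv_clm_apply h1 (differentiableAt_const _)]
  simp [iteratedFDeriv_two_apply]

lemma _root_.ContDiff.laplacian {G : Type*} [NormedAddCommGroup G] [NormedSpace ℝ G]
    {f : E d → G} (hf : ContDiff ℝ ∞ f) : ContDiff ℝ ∞ (Laplacian.laplacian f) := by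
  have h2 : ContDiff ℝ 2 f := mod_cast contDiff_infty.1 hf 2
  have : Laplacian.laplacian f = fun x => _ := funext h2.laplacian_apply
  rw [this]
  refine ContDiff.sum fun i _ => ?_
  have h3 : ContDiff ℝ ∞ fun y => fderiv ℝ f y (EuclideanSpace.basisFun (Fin d) ℝ i) :=
    (hf.fderiv_right (m := ∞) (by simp)).clm_apply contDiff_const
  exact (h3.fderiv_right (m := ∞) (by simp)).clm_apply contDiff_const

/-- The difference of the integrands is the divergence of `f ∇g - g ∇f`. The scalars `𝕜` allow
complex characters as well as real functions. -/
lemma torusAvg_mul_laplacian (hf : ContDiff ℝ ∞ f) (hg : ContDiff ℝ ∞ g) (hfp : TorusPeriodic f)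
    (hgp : TorusPeriodic g) :
    torusAvg (fun x => f x * Laplacian.laplacian g x) =
      torusAvg (fun x => Laplacian.laplacian f x * g x) := by
  rw [← sub_eq_zero, ← torusAvg_sub (hfp.comp₂ hgp.laplacian (· * ·))
    (hf.continuous.mul hg.laplacian.continuous) (hfp.laplacian.comp₂ hgp (· * ·))
    (hf.laplacian.continuous.mul hg.continuous)]
  have h2f : ContDiff ℝ 2 f := mod_cast contDiff_infty.1 hf 2
  have h2g : ContDiff ℝ 2 g := mod_cast contDiff_infty.1 hg 2
  set e := EuclideanSpace.basisFun (Fin d) ℝ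
  set P : Fin d → E d → 𝕜 := fun i y => f y * fderiv ℝ g y (e i) - fderiv ℝ f y (e i) * g y with hP
  have hdf : ∀ {f : E d → 𝕜}, ContDiff ℝ 2 f → ∀ i, ContDiff ℝ 1 fun y => fderiv ℝ f y (e i) :=
    fun hf i => (hf.fderiv_right (m := 1) le_rfl).clm_apply contDiff_const
  have hPs : ∀ i, ContDiff ℝ 1 (P i) := fun i =>
    ((contDiff_infty.1 hf 1 |>.of_le (by simp)).mul (hdf h2g i)).sub
      ((hdf h2f i).mul (contDiff_infty.1 hg 1 |>.of_le (by simp)))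
  have hPp : ∀ i, TorusPeriodic (P i) := fun i =>
    (hfp.comp₂ (hgp.fderiv_apply _) (· * ·)).comp₂ ((hfp.fderiv_apply _).comp₂ hgp (· * ·)) (· - ·)
  have key : (fun x => f x * Laplacian.laplacian g x - Laplacian.laplacian f x * g x) =
      fun x => ∑ i, fderiv ℝ (P i) x (e i) := by
    ext x
    rw [h2f.laplacian_apply, h2g.laplacian_apply, Finset.mul_sum, Finset.sum_mul,
      ← Finset.sum_sub_distrib]
    refine Finset.sum_congr rfl fun i _ => ?_
    have d1 := (hf.differentiable (by simp) x)
    have d2 := (hg.differentiable (by simp) x)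
    have d3 := ((hdf h2g i).differentiable one_ne_zero x)
    have d4 := ((hdf h2f i).differentiable one_ne_zero x)
    have : HasFDerivAt (P i) _ x := (d1.hasFDerivAt.mul d3.hasFDerivAt).sub
      (d4.hasFDerivAt.mul d2.hasFDerivAt)
    rw [this.fderiv]
    simp only [sub_apply, add_apply,
      smul_apply, smul_eq_mul, e]
    ring
  rw [key, torusAvg_sum _ (fun i => (hPp i).fderiv_apply _)
    (fun i => (hPs i).continuous_fderiv_const_apply _)]
  exact Finset.sum_eq_zero fun i _ => torusAvg_fderiv_eq_zero (hPp i) (hPs i) _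

lemma laplacianPow_succ (j : ℕ) (f : E d → ℝ) :
    laplacianPow (j + 1) f = Laplacian.laplacian (laplacianPow j f) :=
  Function.iterate_succ_apply' _ j f

lemma laplacianPow_add (i j : ℕ) (f : E d → ℝ) :
    laplacianPow (i + j) f = laplacianPow i (laplacianPow j f) :=
  Function.iterate_add_apply _ i j f

lemma _root_.ContDiff.laplacianPow {f : E d → ℝ} (hf : ContDiff ℝ ∞ f) (j : ℕ) :
    ContDiff ℝ ∞ (laplacianPow j f) := by
  induction j with
  | zero => exact hf
  | succ j ih => rw [laplacianPow_succ]; exact ih.laplacian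

lemma TorusPeriodic.laplacianPow {f : E d → ℝ} (hf : TorusPeriodic f) (j : ℕ) :
    TorusPeriodic (laplacianPow j f) := by
  induction j with
  | zero => exact hf
  | succ j ih => rw [laplacianPow_succ]; exact ih.laplacian

lemma torusAvg_mul_laplacianPow {f g : E d → ℝ} (hf : ContDiff ℝ ∞ f) (hg : ContDiff ℝ ∞ g)
    (hfp : TorusPeriodic f) (hgp : TorusPeriodic g) (j : ℕ) :
    torusAvg (fun x => f x * laplacianPow j g x) =
      torusAvg (fun x => laplacianPow j f x * g x) := by
  induction j generalizing g with
  | zero => rfl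
  | succ j ih =>
    have h1 : laplacianPow (j + 1) g = laplacianPow j (Laplacian.laplacian g) :=
      laplacianPow_add j 1 g
    rw [h1, ih hg.laplacian hgp.laplacian, laplacianPow_succ]
    exact torusAvg_mul_laplacian (hf.laplacianPow j) hg (hfp.laplacianPow j) hgp

lemma torusAvg_mul_laplacianPow_two_mul {f : E d → ℝ} (hf : ContDiff ℝ ∞ f)
    (hfp : TorusPeriodic f) (k : ℕ) :
    torusAvg (fun x => f x * laplacianPow (2 * k) f x) =
      torusAvg (fun x => laplacianPow k f x ^ 2) := by
  rw [two_mul, laplacianPow_add, torusAvg_mul_laplacianPow hf (hf.laplacianPow k) hfp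
    (hfp.laplacianPow k)]
  simp only [sq]

lemma torusAvg_laplacianPow {f : E d → ℝ} (hf : ContDiff ℝ ∞ f) (hfp : TorusPeriodic f) {j : ℕ}
    (hj : j ≠ 0) : torusAvg (laplacianPow j f) = 0 := by
  obtain ⟨j, rfl⟩ := Nat.exists_eq_succ_of_ne_zero hj
  have := torusAvg_mul_laplacian (f := fun _ : E d => (1 : ℝ)) contDiff_const (hf.laplacianPow j)
    (fun _ _ _ => rfl) (hfp.laplacianPow j)
  simpa [← laplacianPow_succ, torusAvg] using this

lemma torusAvg_divergence_mul {X : E d → E d} {u : E d → ℝ} (hX : ContDiff ℝ 1 X)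
    (hu : ContDiff ℝ 1 u) (hXp : TorusPeriodic X) (hup : TorusPeriodic u) :
    torusAvg (fun x => divergence X x * u x + inner ℝ (X x) (gradient u x)) = 0 := by
  set P : Fin d → E d → ℝ := fun i y => X y i * u y
  have hPs : ∀ i, ContDiff ℝ 1 (P i) := fun i => (contDiff_euclidean.1 hX i).mul hu
  have hPp : ∀ i, TorusPeriodic (P i) := fun i => hXp.comp₂ hup fun v t => v i * t
  have key : (fun x => divergence X x * u x + inner ℝ (X x) (gradient u x)) =
      fun x => ∑ i, fderiv ℝ (P i) x (EuclideanSpace.single i 1) := by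
    ext x
    have hin : inner ℝ (X x) (gradient u x) =
        ∑ i, X x i * fderiv ℝ u x (EuclideanSpace.single i 1) := by
      rw [real_inner_comm, inner_gradient_left]
      conv_lhs => rw [← (EuclideanSpace.basisFun (Fin d) ℝ).sum_repr (X x)]
      simp [map_sum]
    rw [hin, divergence, Finset.sum_mul, ← Finset.sum_add_distrib]
    refine Finset.sum_congr rfl fun i _ => ?_
    have d1 : HasFDerivAt (fun y => X y i)
        ((EuclideanSpace.proj i : E d →L[ℝ] ℝ).comp (fderiv ℝ X x)) x :=
      (EuclideanSpace.proj i : E d →L[ℝ] ℝ).hasFDerivAt.comp x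
        (hX.differentiable one_ne_zero x).hasFDerivAt
    have : HasFDerivAt (P i) _ x := d1.mul (hu.differentiable one_ne_zero x).hasFDerivAt
    rw [this.fderiv]
    simp only [add_apply, smul_apply, smul_eq_mul,
      ContinuousLinearMap.comp_apply, PiLp.proj_apply]
    ring
  rw [key, torusAvg_sum _ (fun i => (hPp i).fderiv_apply _)
    (fun i => (hPs i).continuous_fderiv_const_apply _)]
  exact Finset.sum_eq_zero fun i _ => torusAvg_fderiv_eq_zero (hPp i) (hPs i) _

end Green

/-! ### Fourier series and the Sobolev (Lipschitz) estimate. -/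

section Fourier

open UnitAddTorus Complex

/-- An integer frequency vector as an element of `ℝ^d`. -/
def freq (n : Fin d → ℤ) : E d := WithLp.toLp 2 fun i => (n i : ℝ)

lemma norm_freq_sq (n : Fin d → ℤ) : ‖freq n‖ ^ 2 = ∑ i, (n i : ℝ) ^ 2 := by
  simp [freq, EuclideanSpace.norm_sq_eq]

lemma abs_le_norm_freq (n : Fin d → ℤ) (i : Fin d) : |(n i : ℝ)| ≤ ‖freq n‖ :=
  PiLp.norm_apply_le (freq n) i

lemma one_le_norm_freq {n : Fin d → ℤ} (hn : n ≠ 0) : 1 ≤ ‖freq n‖ := by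
  obtain ⟨i, hi⟩ := Function.ne_iff.1 hn
  refine le_trans ?_ (abs_le_norm_freq n i)
  exact_mod_cast Int.one_le_abs hi

/-- Summability of inverse powers over a lattice of rank `d`, transported to `ℤ^d`. The term `n = 0`
is `0⁻¹ ^ s = 0`. -/
lemma summable_inv_norm_freq_pow {s : ℕ} (hs : d < s) :
    Summable fun n : Fin d → ℤ => ‖freq n‖⁻¹ ^ s := by
  set b := (EuclideanSpace.basisFun (Fin d) ℝ).toBasis
  set L := Submodule.span ℤ (range b)
  have hrank : Module.finrank ℤ L = d := by
    simpa using Module.finrank_eq_card_basis (b.restrictScalars ℤ)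
  have h1 := ZLattice.summable_norm_pow_inv L s (by omega)
  refine (h1.comp_injective (b.restrictScalars ℤ).equivFun.symm.injective).congr fun n => ?_
  have : (((b.restrictScalars ℤ).equivFun.symm n : L) : E d) = freq n := by
    have hb : ∀ c, ((b.restrictScalars ℤ c : L) : E d) = b c := b.restrictScalars_apply ℤ
    rw [Module.Basis.equivFun_symm_apply, Submodule.coe_sum]
    simp only [Submodule.coe_smul, hb]
    ext i
    simp [b, freq, Finset.sum_apply, Pi.single_apply]
  simp only [Function.comp_apply, ← this]
  rfl

lemma mFourier_proj (n : Fin d → ℤ) (x : E d) :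
    mFourier n (proj x) = cexp ((2 * Real.pi * inner ℝ (freq n) x : ℝ) * I) := by
  have : mFourier n (proj x) = ∏ i, fourier (n i) (x i : UnitAddCircle) := rfl
  rw [this]
  simp only [fourier_coe_apply, ← Complex.exp_sum]
  congr 1
  simp only [PiLp.inner_apply, freq, RCLike.inner_apply, conj_trivial]
  rw [ofReal_mul, ofReal_sum, Finset.mul_sum, Finset.sum_mul]
  refine Finset.sum_congr rfl fun i _ => ?_
  push_cast
  ring

lemma contDiff_mFourier_proj (n : Fin d → ℤ) :
    ContDiff ℝ ∞ fun x : E d => mFourier n (proj x) := by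
  simp only [mFourier_proj]
  have h : ContDiff ℝ ∞ fun x : E d => 2 * Real.pi * inner ℝ (freq n) x :=
    contDiff_const.mul (contDiff_const.inner ℝ contDiff_id)
  exact ((Complex.ofRealCLM.contDiff.comp h).mul contDiff_const).cexp

lemma fderiv_mFourier_proj (n : Fin d → ℤ) (x v : E d) :
    fderiv ℝ (fun x : E d => mFourier n (proj x)) x v =
      ((2 * Real.pi * inner ℝ (freq n) v : ℝ) * I) * mFourier n (proj x) := by
  have h1 : HasFDerivAt (fun x : E d => 2 * Real.pi * inner ℝ (freq n) x)
      ((2 * Real.pi) • innerSL ℝ (freq n)) x := by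
    simpa using! ((innerSL ℝ (freq n)).hasFDerivAt (x := x)).const_mul (2 * Real.pi)
  have h2 := ((Complex.ofRealCLM.hasFDerivAt.comp x h1).mul_const I).cexp
  have h3 : (fun x : E d => mFourier n (proj x)) =
      fun x => cexp ((2 * Real.pi * inner ℝ (freq n) x : ℝ) * I) := funext (mFourier_proj n)
  rw [h3, mFourier_proj]
  rw [show fderiv ℝ (fun x : E d => cexp ((2 * Real.pi * inner ℝ (freq n) x : ℝ) * I)) x = _ from
    h2.fderiv]
  simp [mul_comm, mul_left_comm]

lemma laplacian_mFourier_proj (n : Fin d → ℤ) (x : E d) :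
    Laplacian.laplacian (fun x : E d => mFourier n (proj x)) x =
      (-(4 * Real.pi ^ 2 * ‖freq n‖ ^ 2) : ℝ) * mFourier n (proj x) := by
  have h2 : ContDiff ℝ 2 fun x : E d => mFourier n (proj x) :=
    mod_cast contDiff_infty.1 (contDiff_mFourier_proj n) 2
  rw [h2.laplacian_apply]
  simp only [fderiv_mFourier_proj]
  have h3 : ∀ i, fderiv ℝ (fun y : E d => ((2 * Real.pi * inner ℝ (freq n)
      (EuclideanSpace.basisFun (Fin d) ℝ i) : ℝ) * I) * mFourier n (proj y)) x
      (EuclideanSpace.basisFun (Fin d) ℝ i) =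
      ((-(4 * Real.pi ^ 2) * (n i) ^ 2 : ℝ) : ℂ) * mFourier n (proj x) := by
    intro i
    rw [fderiv_const_mul (h2.differentiable two_ne_zero x), smul_apply, fderiv_mFourier_proj]
    simp only [freq, EuclideanSpace.basisFun_apply, EuclideanSpace.inner_single_right, smul_eq_mul,
      conj_trivial, one_mul]
    push_cast
    linear_combination (4 * (Real.pi : ℂ) ^ 2 * (n i : ℂ) ^ 2 * mFourier n (proj x)) * I_sq
  rw [Finset.sum_congr rfl fun i _ => h3 i, ← Finset.sum_mul, norm_freq_sq, ← ofReal_sum,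
    ← Finset.mul_sum]
  congr 2
  ring

/-- The Fourier coefficients of a periodic function on `ℝ^d`. -/
def periodicCoeff (f : E d → ℝ) (n : Fin d → ℤ) : ℂ :=
  torusAvg fun x => mFourier (-n) (proj x) * (f x : ℂ)

lemma torusPeriodic_mFourier (n : Fin d → ℤ) :
    TorusPeriodic fun x : E d => mFourier n (proj x) := fun x y h => by simp only [h]

/-- The Laplacian is symmetric and characters are its eigenfunctions. -/
lemma periodicCoeff_laplacian {f : E d → ℝ} (hf : ContDiff ℝ ∞ f) (hfp : TorusPeriodic f)
    (n : Fin d → ℤ) : periodicCoeff (Laplacian.laplacian f) n =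
      (-(4 * Real.pi ^ 2 * ‖freq n‖ ^ 2) : ℝ) * periodicCoeff f n := by
  have h2 : ContDiff ℝ 2 f := mod_cast contDiff_infty.1 hf 2
  have h1 : ∀ x, ((Laplacian.laplacian f x : ℝ) : ℂ) =
      Laplacian.laplacian (fun y => (f y : ℂ)) x := fun x =>
    ((h2.contDiffAt (x := x)).laplacian_CLM_comp_left (l := Complex.ofRealCLM)).symm
  simp only [periodicCoeff, h1]
  have h3 : ContDiff ℝ ∞ fun y => (f y : ℂ) := Complex.ofRealCLM.contDiff.comp hf
  rw [torusAvg_mul_laplacian (contDiff_mFourier_proj (-n)) h3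
    (torusPeriodic_mFourier (-n)) (hfp.comp _)]
  have h4 : ‖freq (-n)‖ ^ 2 = ‖freq n‖ ^ 2 := by simp [norm_freq_sq]
  simp only [laplacian_mFourier_proj, mul_assoc, torusAvg, h4]
  exact integral_const_mul _ _

lemma periodicCoeff_laplacianPow {f : E d → ℝ} (hf : ContDiff ℝ ∞ f) (hfp : TorusPeriodic f)
    (n : Fin d → ℤ) (k : ℕ) : periodicCoeff (laplacianPow k f) n =
      (-(4 * Real.pi ^ 2 * ‖freq n‖ ^ 2) : ℝ) ^ k * periodicCoeff f n := by
  induction k with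
  | zero => simp [laplacianPow]
  | succ k ih =>
    rw [laplacianPow_succ, periodicCoeff_laplacian (hf.laplacianPow k) (hfp.laplacianPow k), ih]
    ring

/-- The continuous function on the torus that corresponds to a continuous periodic function. -/
def descend {f : E d → ℝ} (hf : Continuous f) (hfp : TorusPeriodic f) : C(Torus d, ℂ) :=
  ⟨fun x => (f (rep x) : ℂ), Complex.continuous_ofReal.comp (hfp.continuous_comp_rep hf)⟩

lemma mFourierCoeff_descend {f : E d → ℝ} (hf : Continuous f) (hfp : TorusPeriodic f)
    (n : Fin d → ℤ) : mFourierCoeff (descend hf hfp) n = periodicCoeff f n := by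
  have : periodicCoeff f n =
      ∫ x, mFourier (-n) x • descend hf hfp x ∂torusMeasure d := by
    simp [periodicCoeff, torusAvg, descend]
  rw [this]
  rfl

/-- Parseval's identity for periodic functions. -/
lemma hasSum_sq_periodicCoeff {f : E d → ℝ} (hf : Continuous f) (hfp : TorusPeriodic f) :
    HasSum (fun n => ‖periodicCoeff f n‖ ^ 2) (torusAvg fun x => f x ^ 2) := by
  have h := hasSum_sq_mFourierCoeff (ContinuousMap.toLp 2 (torusMeasure d) ℂ (descend hf hfp))
  have h2 : ∀ n, mFourierCoeff (ContinuousMap.toLp 2 (torusMeasure d) ℂ (descend hf hfp)) n =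
      periodicCoeff f n := fun n =>
    (mFourierCoeff_toLp (descend hf hfp) n).trans (mFourierCoeff_descend hf hfp n)
  have h3 : (fun x => ‖ContinuousMap.toLp 2 (torusMeasure d) ℂ (descend hf hfp) x‖ ^ 2)
      =ᵐ[torusMeasure d] fun x => f (rep x) ^ 2 := by
    filter_upwards [ContinuousMap.coeFn_toLp (p := 2) (𝕜 := ℂ) (torusMeasure d) (descend hf hfp)]
      with x hx
    rw [hx]
    simp [descend]
  have h4 := (integral_congr_ae h3).symm
  simp only [torusAvg, h4]
  exact h.congr_fun fun n => congrArg (fun z : ℂ => ‖z‖ ^ 2) (h2 n).symm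

lemma hasSum_periodicCoeff {f : E d → ℝ} (hf : Continuous f) (hfp : TorusPeriodic f)
    (hs : Summable (periodicCoeff f)) (x : E d) :
    HasSum (fun n => periodicCoeff f n * mFourier n (proj x)) (f x : ℂ) := by
  have h1 : mFourierCoeff (descend hf hfp) = periodicCoeff f :=
    funext (mFourierCoeff_descend hf hfp)
  have := hasSum_mFourier_series_apply_of_summable (f := descend hf hfp) (h1 ▸ hs) (proj x)
  rw [h1] at this
  simpa [descend, hfp.apply_rep_proj] using this

lemma norm_fourier_sub_le (n : ℤ) (a b : UnitAddCircle) :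
    ‖fourier n a - fourier n b‖ ≤ 2 * Real.pi * |(n : ℝ)| * dist a b := by
  obtain ⟨s, rfl⟩ := QuotientAddGroup.mk_surjective b
  obtain ⟨r, rfl⟩ := QuotientAddGroup.mk_surjective a
  -- Replace `r` by the representative `s + t` nearest to `s`, so that `|t|` is the distance on the
  -- circle; then `|e^{iθ} - 1| ≤ |θ|` suffices.
  have hdist : dist (r : UnitAddCircle) (s : UnitAddCircle) = |r - s - round (r - s)| := by
    rw [dist_eq_norm, ← AddCircle.coe_sub, UnitAddCircle.norm_eq]
  set t : ℝ := r - s - round (r - s)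
  have hr : (r : UnitAddCircle) = ((s + t : ℝ) : UnitAddCircle) := by
    have : r = s + t + (round (r - s) : ℤ) := by simp only [t]; ring
    rw [this, AddCircle.coe_add _ (s + t)]
    simp
  change ‖fourier n (r : UnitAddCircle) - fourier n (s : UnitAddCircle)‖ ≤
    _ * dist (r : UnitAddCircle) (s : UnitAddCircle)
  rw [hdist, hr, fourier_coe_apply, fourier_coe_apply]
  have h1 : 2 * Real.pi * I * n * ((s + t : ℝ) : ℂ) / (1 : ℝ) =
      ((2 * Real.pi * n * s : ℝ) : ℂ) * I + I * ((2 * Real.pi * n * t : ℝ) : ℂ) := by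
    push_cast; ring
  have h2 : 2 * Real.pi * I * n * (s : ℂ) / (1 : ℝ) = ((2 * Real.pi * n * s : ℝ) : ℂ) * I := by
    push_cast; ring
  rw [h1, h2, Complex.exp_add, ← mul_sub_one, norm_mul, Complex.norm_exp_ofReal_mul_I, one_mul]
  refine (Real.norm_exp_I_mul_ofReal_sub_one_le).trans (le_of_eq ?_)
  rw [Real.norm_eq_abs, abs_mul, abs_mul, abs_of_pos Real.two_pi_pos]

lemma norm_prod_sub_prod_le_sum {ι : Type*} (s : Finset ι) (a b : ι → ℂ) (ha : ∀ i, ‖a i‖ ≤ 1)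
    (hb : ∀ i, ‖b i‖ ≤ 1) : ‖∏ i ∈ s, a i - ∏ i ∈ s, b i‖ ≤ ∑ i ∈ s, ‖a i - b i‖ := by
  classical
  induction s using Finset.induction_on with
  | empty => simp
  | insert i s hi ih =>
    rw [Finset.prod_insert hi, Finset.prod_insert hi, Finset.sum_insert hi]
    have h1 : a i * ∏ j ∈ s, a j - b i * ∏ j ∈ s, b j =
        (a i - b i) * ∏ j ∈ s, a j + b i * (∏ j ∈ s, a j - ∏ j ∈ s, b j) := by ring
    have h2 : ‖∏ j ∈ s, a j‖ ≤ 1 := by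
      rw [norm_prod]; exact Finset.prod_le_one (fun _ _ => norm_nonneg _) fun j _ => ha j
    rw [h1]
    refine (norm_add_le _ _).trans (add_le_add ?_ ?_)
    · rw [norm_mul]; exact mul_le_of_le_one_right (norm_nonneg _) h2
    · rw [norm_mul]; exact (mul_le_of_le_one_left (norm_nonneg _) (hb i)).trans ih

/-- Telescoping over the `d` unimodular factors; the distance is the sup distance, which accounts
for the factor `d`. -/
lemma norm_mFourier_sub_le (n : Fin d → ℤ) (x y : Torus d) :
    ‖mFourier n x - mFourier n y‖ ≤ 2 * Real.pi * d * ‖freq n‖ * dist x y := by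
  refine (norm_prod_sub_prod_le_sum Finset.univ (fun i => fourier (n i) (x i))
    (fun i => fourier (n i) (y i)) (fun i => (Circle.norm_coe _).le)
    fun i => (Circle.norm_coe _).le).trans ?_
  have : ∀ i ∈ Finset.univ, ‖fourier (n i) (x i) - fourier (n i) (y i)‖ ≤
      2 * Real.pi * ‖freq n‖ * dist x y := fun i _ => by
    refine (norm_fourier_sub_le _ _ _).trans ?_
    have := abs_le_norm_freq n i
    have := dist_le_pi_dist x y i
    gcongr
  refine (Finset.sum_le_card_nsmul _ _ _ this).trans (le_of_eq ?_)
  simp only [Finset.card_univ, Fintype.card_fin, nsmul_eq_mul]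
  ring

/-- A Sobolev inequality on the torus: a bound on `Δ^k f` in `L²` gives a Lipschitz bound. -/
theorem exists_dist_le_of_laplacianPow {k : ℕ} (hk : d + 2 < 4 * k) :
    ∃ S : ℝ, ∀ f : Torus d → ℝ, Smooth f → ∀ x y,
      |f x - f y| ≤ Real.pi * d * (torusAvg (fun z => laplacianPow k (lift f) z ^ 2) + S) *
        dist x y := by
  have hsum := summable_inv_norm_freq_pow (d := d) (s := 4 * k - 2) (by omega)
  refine ⟨∑' n : Fin d → ℤ, ‖freq n‖⁻¹ ^ (4 * k - 2), fun f hf x y => ?_⟩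
  have hfp := torusPeriodic_lift f
  have hfc : Continuous (lift f) := ContDiff.continuous hf
  set A := torusAvg fun z => laplacianPow k (lift f) z ^ 2
  set c := periodicCoeff (lift f)
  have hpars := hasSum_sq_periodicCoeff (ContDiff.laplacianPow hf k).continuous
    (hfp.laplacianPow k)
  -- Write `|n| |c n|` as `|n|^{2k} |c n|` times `|n|^{-(2k-1)}` and use `ab ≤ (a² + b²) / 2`. The
  -- second squares are summable because `4k - 2 > d`.
  have hbound : ∀ n, ‖freq n‖ * ‖c n‖ ≤
      (‖periodicCoeff (laplacianPow k (lift f)) n‖ ^ 2 + ‖freq n‖⁻¹ ^ (4 * k - 2)) / 2 := by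
    intro n
    have hcoef : ‖freq n‖ ^ (2 * k) * ‖c n‖ ≤ ‖periodicCoeff (laplacianPow k (lift f)) n‖ := by
      rw [periodicCoeff_laplacianPow hf hfp, norm_mul, norm_pow, Complex.norm_real, norm_neg,
        Real.norm_of_nonneg (by positivity), pow_mul]
      gcongr
      have h3 : 1 ≤ 4 * Real.pi ^ 2 := by nlinarith [Real.pi_gt_three]
      exact le_mul_of_one_le_left (by positivity) h3
    have hsplit : ‖freq n‖ * ‖c n‖ =
        (‖freq n‖ ^ (2 * k) * ‖c n‖) * ‖freq n‖⁻¹ ^ (2 * k - 1) := by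
      rcases eq_or_ne ‖freq n‖ 0 with h0 | h0
      · rw [h0]; simp [show k ≠ 0 by omega]
      · have : ‖freq n‖ ^ (2 * k) = ‖freq n‖ * ‖freq n‖ ^ (2 * k - 1) := by
          rw [← pow_succ']; congr 1; omega
        rw [this, inv_pow]
        field_simp
    have hsq : ‖freq n‖⁻¹ ^ (4 * k - 2) = (‖freq n‖⁻¹ ^ (2 * k - 1)) ^ 2 := by
      rw [← pow_mul]; congr 1; omega
    have h5 : 0 ≤ ‖freq n‖⁻¹ ^ (2 * k - 1) := by positivity
    rw [hsplit, hsq]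
    have h6 := mul_le_mul_of_nonneg_right hcoef h5
    nlinarith [sq_nonneg (‖periodicCoeff (laplacianPow k (lift f)) n‖ -
      ‖freq n‖⁻¹ ^ (2 * k - 1))]
  have hmaj := (hpars.add hsum.hasSum).div_const 2
  have hsum1 : Summable fun n => ‖freq n‖ * ‖c n‖ :=
    Summable.of_nonneg_of_le (fun n => by positivity) hbound hmaj.summable
  -- The weight `|n|` vanishes at `n = 0`, so the comparison excludes that frequency.
  have hsumc : Summable c := by
    refine Summable.of_norm_bounded_eventually hsum1 ?_
    filter_upwards [(finite_singleton (0 : Fin d → ℤ)).compl_mem_cofinite] with n hn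
    exact le_mul_of_one_le_left (norm_nonneg _) (one_le_norm_freq hn)
  have hx := hasSum_periodicCoeff hfc hfp hsumc (rep x)
  have hy := hasSum_periodicCoeff hfc hfp hsumc (rep y)
  have hxy := hx.sub hy
  simp only [proj_rep, lift_rep] at hxy
  have hterm : ∀ n, ‖c n * mFourier n x - c n * mFourier n y‖ ≤
      2 * Real.pi * d * dist x y * (‖freq n‖ * ‖c n‖) := by
    intro n
    rw [← mul_sub, norm_mul]
    calc _ ≤ ‖c n‖ * (2 * Real.pi * d * ‖freq n‖ * dist x y) := by
          gcongr; exact norm_mFourier_sub_le n x y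
      _ = _ := by ring
  have h7 := hxy.norm_le_of_bounded (hsum1.hasSum.mul_left _) hterm
  rw [← Complex.ofReal_sub, Complex.norm_real, Real.norm_eq_abs] at h7
  have h8 := hasSum_le hbound hsum1.hasSum hmaj
  refine h7.trans ?_
  calc _ ≤ 2 * Real.pi * d * dist x y * ((A + ∑' n : Fin d → ℤ, ‖freq n‖⁻¹ ^ (4 * k - 2)) / 2) := by
        gcongr
    _ = _ := by ring

end Fourier

/-! ### Integrations by parts, packaged as functions of mean zero. -/

section ZeroMean

/-- `F` is continuous and periodic and has mean zero over the torus. -/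
structure ZeroMean (F : E d → ℝ) : Prop where
  periodic : TorusPeriodic F
  continuous : Continuous F
  avg_eq_zero : torusAvg F = 0

namespace ZeroMean

variable {F F₁ : E d → ℝ}

lemma add (hF : ZeroMean F) (hF₁ : ZeroMean F₁) : ZeroMean fun x => F x + F₁ x where
  periodic := hF.periodic.comp₂ hF₁.periodic (· + ·)
  continuous := hF.continuous.add hF₁.continuous
  avg_eq_zero := by
    rw [torusAvg_add hF.periodic hF.continuous hF₁.periodic hF₁.continuous, hF.avg_eq_zero,
      hF₁.avg_eq_zero, add_zero]

lemma const_mul (hF : ZeroMean F) (c : ℝ) : ZeroMean fun x => c * F x where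
  periodic := hF.periodic.comp (c * ·)
  continuous := continuous_const.mul hF.continuous
  avg_eq_zero := by
    have : torusAvg (fun x => c * F x) = c * torusAvg F := integral_const_mul _ _
    rw [this, hF.avg_eq_zero, mul_zero]

end ZeroMean

lemma zeroMean_laplacianPow {f : E d → ℝ} (hf : ContDiff ℝ ∞ f) (hfp : TorusPeriodic f) {j : ℕ}
    (hj : j ≠ 0) : ZeroMean (laplacianPow j f) :=
  ⟨hfp.laplacianPow j, (hf.laplacianPow j).continuous, torusAvg_laplacianPow hf hfp hj⟩

lemma zeroMean_mul_laplacianPow_sub {f : E d → ℝ} (hf : ContDiff ℝ ∞ f) (hfp : TorusPeriodic f)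
    (k : ℕ) : ZeroMean fun x => f x * laplacianPow (2 * k) f x - laplacianPow k f x ^ 2 := by
  have h1 : TorusPeriodic fun x => f x * laplacianPow (2 * k) f x :=
    hfp.comp₂ (hfp.laplacianPow _) (· * ·)
  have h2 : TorusPeriodic fun x => laplacianPow k f x ^ 2 := (hfp.laplacianPow k).comp (· ^ 2)
  have c1 : Continuous fun x => f x * laplacianPow (2 * k) f x :=
    hf.continuous.mul (hf.laplacianPow _).continuous
  have c2 : Continuous fun x => laplacianPow k f x ^ 2 := (hf.laplacianPow k).continuous.pow 2
  refine ⟨h1.comp₂ h2 (· - ·), c1.sub c2, ?_⟩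
  rw [torusAvg_sub h1 c1 h2 c2, torusAvg_mul_laplacianPow_two_mul hf hfp, sub_self]

lemma zeroMean_divergence {X : E d → E d} {u : E d → ℝ} (hX : ContDiff ℝ 1 X)
    (hu : ContDiff ℝ 1 u) (hXp : TorusPeriodic X) (hup : TorusPeriodic u) :
    ZeroMean fun x => divergence X x * u x + inner ℝ (X x) (gradient u x) := by
  have hdiv : TorusPeriodic (divergence X) :=
    hXp.fderiv.comp fun T => ∑ i, T (EuclideanSpace.single i 1) i
  have hdivc : Continuous (divergence X) := continuous_finsetSum _ fun i _ =>
    (EuclideanSpace.proj i : E d →L[ℝ] ℝ).continuous.comp (hX.continuous_fderiv_const_apply _)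
  have hgradc : Continuous (gradient u) :=
    (InnerProductSpace.toDual ℝ (E d)).symm.continuous.comp (hu.continuous_fderiv one_ne_zero)
  exact ⟨(hdiv.comp₂ hup (· * ·)).comp₂ (hXp.comp₂ hup.gradient (inner ℝ)) (· + ·),
    (hdivc.mul hu.continuous).add (hX.continuous.inner hgradc),
    torusAvg_divergence_mul hX hu hXp hup⟩

end ZeroMean

/-! ### The uniform energy estimate. -/

section Energy

variable {k : ℕ} {H : E d → ℝ} {g : ℝ → ℝ} {V φ : Torus d → ℝ} {ε : ℝ} {p : ℝ → ℝ} {lam : ℝ}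
  {m u : Torus d → ℝ}

lemma _root_.ContDiff.gradient {f : E d → ℝ} {n r : WithTop ℕ∞} (hf : ContDiff ℝ n f)
    (hr : r + 1 ≤ n) : ContDiff ℝ r (gradient f) :=
  (InnerProductSpace.toDual ℝ (E d)).symm.contDiff.comp (hf.fderiv_right hr)

lemma IsPenalty.continuous_comp (hp : IsPenalty d ε p) {f : E d → ℝ} (hf : Continuous f)
    (hpos : ∀ x, 0 < f x) : Continuous fun x => p (f x) :=
  hp.smooth.continuousOn.comp_continuous hf hpos

/-- No regularity of `V` is assumed: the first equation expresses `λ V` through continuous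
functions. -/
lemma IsSmoothSolution.continuous_potential (h : IsSmoothSolution k H g V φ ε p lam m u)
    (hH : ContDiff ℝ 2 H) (hg : ContinuousOn g (Ici 0)) (hp : IsPenalty d ε p) :
    Continuous fun x => lam * lift V x := by
  have hm := h.smooth_m.continuous
  have hmpos : ∀ x, 0 < lift m x := fun x => h.pos _
  have h1 : Continuous fun x => g (lift m x) := hg.comp_continuous hm fun x => (hmpos x).le
  have h2 := hp.continuous_comp hm hmpos
  have h3 : Continuous fun x => H (gradient (lift u) x) :=
    hH.continuous.comp (h.smooth_u.gradient (r := 0) (by simp)).continuous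
  have h4 := (ContDiff.laplacianPow h.smooth_m (2 * k)).continuous
  have h5 := h.smooth_u.continuous
  have : (fun x => lam * lift V x) = fun x => -lift u x - lam * H (gradient (lift u) x) +
      lam * g (lift m x) + p (lift m x) +
      ε * (lift m x + laplacianPow (2 * k) (lift m) x) := by
    ext x
    have := h.hj x
    rw [opHJ] at this
    linarith
  rw [this]
  exact ((((h5.neg.sub (h3.const_mul lam)).add (h1.const_mul lam)).add h2).add
    ((hm.add h4).const_mul ε))

/-- The potential is bounded if the system has a solution for a positive parameter. -/
lemma exists_abs_potential_le (hH : ContDiff ℝ 2 H) (hg : ContinuousOn g (Ici 0))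
    (hp : IsPenalty d ε p) : ∃ B : ℝ, 0 ≤ B ∧ ∀ lam ∈ Icc (0 : ℝ) 1, ∀ m u : Torus d → ℝ,
      IsSmoothSolution k H g V φ ε p lam m u → ∀ x, |lam * lift V x| ≤ B := by
  -- One solution with `λ ≠ 0` makes `V` continuous, hence bounded; if there is none, `λ V` is zero
  -- for every solution.
  by_cases hex : ∃ lam m u, lam ≠ 0 ∧ IsSmoothSolution k H g V φ ε p lam m u
  · obtain ⟨lam, m, u, hlam, h⟩ := hex
    have hV : Continuous (lift V) := by
      simpa [hlam] using (h.continuous_potential hH hg hp).const_mul lam⁻¹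
    obtain ⟨C, hC⟩ := (torusPeriodic_lift V).exists_norm_le hV
    have hC0 : 0 ≤ C := (norm_nonneg _).trans (hC 0)
    refine ⟨C, hC0, fun l hl _ _ _ x => ?_⟩
    rw [abs_mul, abs_of_nonneg hl.1]
    exact (mul_le_of_le_one_left (abs_nonneg _) hl.2).trans (hC x)
  · push Not at hex
    refine ⟨0, le_rfl, fun l _ m u h x => ?_⟩
    have : l = 0 := by
      by_contra hl
      exact hex l m u hl h
    simp [this]

/-- The pointwise form of the energy estimate. Here `s`, `a`, `h`, `G`, `P`, `W`, `f` stand for the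
values of `u`, `D_pH(Du)·Du - H(Du)`, `H(Du)`, `g(m)`, `p(m)`, `λ V` and `φ`. -/
lemma energy_lower_bound {t s a h G P W f D D' C₁ C₂ G₁ B Φ : ℝ} (hlam : lam ∈ Icc (0 : ℝ) 1)
    (hε : ε ∈ Ioo (0 : ℝ) 1) (ht : 0 < t) (hC₁ : 0 ≤ C₁) (ha : -C₁ ≤ a) (hC₂ : 0 ≤ C₂)
    (hh : -C₂ ≤ h) (hG₁ : 0 ≤ G₁) (hG : -G₁ ≤ (t - 1) * G) (hW : |W| ≤ B)
    (hP : (1 - ε) * -P ≤ P * (t - 1)) (hf : 0 ≤ f) (hfΦ : f ≤ Φ) (hD' : 0 ≤ D') :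
    (1 - ε) * -P + ε * D -
        (C₂ + G₁ + B + (C₁ + B + ε) ^ 2 / (4 * ε) + (Φ + 1) ^ 2 / (4 * ε)) ≤
      lam * t * a + lam * ((t - 1) * G) + lam * h - W * (t - 1) + P * (t - 1) +
        ε * (t ^ 2 - t + D) + ε * (s ^ 2 + D') - (lam * f + 1 - lam) * s + s := by
  obtain ⟨hl0, hl1⟩ := hlam
  obtain ⟨he0, he1⟩ := hε
  have e1 : -(C₁ * t) ≤ lam * t * a := by
    have h1 : 0 ≤ lam * t := by positivity
    nlinarith [mul_le_mul_of_nonneg_left ha h1,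
      mul_nonneg (mul_nonneg (sub_nonneg.2 hl1) ht.le) hC₁]
  have e2 : -G₁ ≤ lam * ((t - 1) * G) := by
    nlinarith [mul_le_mul_of_nonneg_left hG hl0, mul_nonneg (sub_nonneg.2 hl1) hG₁]
  have e3 : -C₂ ≤ lam * h := by
    nlinarith [mul_le_mul_of_nonneg_left hh hl0, mul_nonneg (sub_nonneg.2 hl1) hC₂]
  have e4 : -(B * t) - B ≤ -(W * (t - 1)) := by
    obtain ⟨h1, h2⟩ := abs_le.1 hW
    nlinarith [mul_le_mul_of_nonneg_right h2 ht.le]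
  -- Complete the square in `t`. The slope collects `C₁` from the Lagrangian term, `B` from the
  -- potential and `ε` from `-ε t`.
  have e5 : -((C₁ + B + ε) ^ 2 / (4 * ε)) ≤ ε * t ^ 2 - (C₁ + B + ε) * t := by
    have : ε * t ^ 2 - (C₁ + B + ε) * t + (C₁ + B + ε) ^ 2 / (4 * ε) =
        (2 * ε * t - (C₁ + B + ε)) ^ 2 / (4 * ε) := by field_simp; ring
    have : 0 ≤ (2 * ε * t - (C₁ + B + ε)) ^ 2 / (4 * ε) := by positivity
    linarith
  -- The terms linear in `s` add up to `-λ (f - 1) s`; complete the square in `s`.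
  have e6 : -((Φ + 1) ^ 2 / (4 * ε)) ≤ ε * s ^ 2 - lam * (f - 1) * s := by
    have h1 : (lam * (f - 1)) ^ 2 ≤ (Φ + 1) ^ 2 := by
      refine sq_le_sq' ?_ ?_
      · nlinarith [mul_nonneg hl0 hf]
      · nlinarith [mul_nonneg (sub_nonneg.2 hl1) hf]
    have h2 : ε * s ^ 2 - lam * (f - 1) * s + (lam * (f - 1)) ^ 2 / (4 * ε) =
        (2 * ε * s - lam * (f - 1)) ^ 2 / (4 * ε) := by field_simp; ring
    have h3 : 0 ≤ (2 * ε * s - lam * (f - 1)) ^ 2 / (4 * ε) := by positivity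
    have h4 : (lam * (f - 1)) ^ 2 / (4 * ε) ≤ (Φ + 1) ^ 2 / (4 * ε) := by gcongr
    linarith
  have e7 : 0 ≤ ε * D' := by positivity
  linarith

/-- A priori bounds, uniform in `lam`, for the penalty and for `Δ^k m` in `L²`. -/
theorem exists_energy_bound (hk : k ≠ 0) (hH : ContDiff ℝ 2 H) (hg_nonneg : ∀ t, 0 ≤ t → 0 ≤ g t)
    (hg_cont : ContinuousOn g (Ici 0)) (hg_mono : MonotoneOn g (Ici 0)) (hφ_cont : Continuous φ)
    (hφ_pos : ∀ x, 0 < φ x)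
    (hH_lagrangian : ∃ C : ℝ, 0 < C ∧ ∀ q : E d, -C ≤ -H q + inner ℝ (gradient H q) q)
    (hH_bdd : ∃ C : ℝ, 0 < C ∧ ∀ q : E d, -C ≤ H q) (hε : ε ∈ Ioo (0 : ℝ) 1)
    (hp : IsPenalty d ε p) :
    ∃ K : ℝ, 0 < K ∧ ∀ lam ∈ Icc (0 : ℝ) 1, ∀ m u : Torus d → ℝ,
      IsSmoothSolution k H g V φ ε p lam m u →
        torusAvg (fun x => -p (lift m x)) ≤ K ∧
        torusAvg (fun x => laplacianPow k (lift m) x ^ 2) ≤ K := by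
  obtain ⟨C₁, hC₁, hL⟩ := hH_lagrangian
  obtain ⟨C₂, hC₂, hHb⟩ := hH_bdd
  obtain ⟨B, hB, hVB⟩ := exists_abs_potential_le (k := k) (V := V) (φ := φ) hH hg_cont hp
  obtain ⟨Φ, hΦ⟩ := (torusPeriodic_lift φ).exists_norm_le (hφ_cont.comp continuous_proj)
  have hG₁ : 0 ≤ g 1 := hg_nonneg 1 zero_le_one
  set C := C₂ + g 1 + B + (C₁ + B + ε) ^ 2 / (4 * ε) + (Φ + 1) ^ 2 / (4 * ε)
  have he0 : 0 < ε := hε.1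
  have he1 : 0 < 1 - ε := sub_pos.2 hε.2
  have hC : 0 < C := by positivity
  -- The estimate bounds `(1 - ε) ∫ -p(m) + ε ∫ (Δ^k m)²` by `C`; since `ε` and `1 - ε` are below
  -- `1`, this quotient serves for both integrals.
  refine ⟨C / ((1 - ε) * ε), by positivity, fun lam hlam m u h => ?_⟩
  have hm := h.smooth_m
  have hu := h.smooth_u
  have hmp := torusPeriodic_lift m
  have hup := torusPeriodic_lift u
  have hmpos : ∀ x, 0 < lift m x := fun x => h.pos _
  set X : E d → E d := fun y => lift m y • gradient H (gradient (lift u) y)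
  have hX : ContDiff ℝ 1 X := by
    have h1 : ContDiff ℝ 1 (gradient (lift u)) := 
      ContDiff.gradient (n := 2) (mod_cast contDiff_infty.1 hu 2) (by norm_num)
    have h2 : ContDiff ℝ 1 (gradient H) := hH.gradient (by norm_num)
    exact (mod_cast contDiff_infty.1 hm 1 : ContDiff ℝ 1 (lift m)).smul (h2.comp h1)
  have hXp : TorusPeriodic X := hmp.comp₂ hup.gradient fun t q => t • gradient H q
  -- All integrations by parts are gathered in one remainder `R` of mean zero, so the energy
  -- inequality can be proved pointwise, with `R` added, and integrated once.
  have hZ := ((((zeroMean_mul_laplacianPow_sub hm hmp k).add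
    ((zeroMean_laplacianPow hm hmp (j := 2 * k) (by omega)).const_mul (-1))).const_mul ε).add
    ((zeroMean_mul_laplacianPow_sub hu hup k).const_mul ε)).add
    ((zeroMean_divergence hX (mod_cast contDiff_infty.1 hu 1) hXp hup).const_mul (-lam))
  set R : E d → ℝ := fun x => ε * (lift m x * laplacianPow (2 * k) (lift m) x -
    laplacianPow k (lift m) x ^ 2 + -1 * laplacianPow (2 * k) (lift m) x) +
    ε * (lift u x * laplacianPow (2 * k) (lift u) x - laplacianPow k (lift u) x ^ 2) +
    -lam * (divergence X x * lift u x + inner ℝ (X x) (gradient (lift u) x)) with hR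
  have hpoint : ∀ x, (1 - ε) * -p (lift m x) + ε * laplacianPow k (lift m) x ^ 2 + R x ≤ C := by
    intro x
    have hGm : -g 1 ≤ (lift m x - 1) * g (lift m x) := by
      have hg0 := hg_nonneg _ (hmpos x).le
      rcases le_total 1 (lift m x) with h1 | h1
      · exact (neg_nonpos.2 hG₁).trans (mul_nonneg (sub_nonneg.2 h1) hg0)
      · have := hg_mono (hmpos x).le (mem_Ici.2 zero_le_one) h1
        nlinarith [hmpos x, mul_nonneg (hmpos x).le hg0]
    have hPm : (1 - ε) * -p (lift m x) ≤ p (lift m x) * (lift m x - 1) := by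
      rcases le_total ε (lift m x) with h1 | h1
      · simp [hp.eq_zero _ h1]
      · nlinarith [mul_nonneg (neg_nonneg.2 (hp.nonpos _ (hmpos x))) (sub_nonneg.2 h1)]
    have key := energy_lower_bound (s := lift u x) (D := laplacianPow k (lift m) x ^ 2) hlam hε
      (hmpos x) hC₁.le (hL (gradient (lift u) x)) hC₂.le (hHb (gradient (lift u) x)) hG₁ hGm
      (hVB lam hlam m u h x) hPm (hφ_pos _).le ((le_abs_self _).trans (hΦ x))
      (sq_nonneg (laplacianPow k (lift u) x))
    have e1 := h.hj x
    have e2 := h.fp x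
    have e3 : inner ℝ (X x) (gradient (lift u) x) =
        lift m x * inner ℝ (gradient H (gradient (lift u) x)) (gradient (lift u) x) :=
      real_inner_smul_left _ _ _
    simp only [opHJ] at e1
    simp only [opFP] at e2
    simp only [hR, e3]
    have e4 : ∀ {a b : ℝ}, a = 0 → b = 0 → a * (lift m x - 1) + b * lift u x = 0 := by
      rintro _ _ rfl rfl; ring
    have e5 := e4 e1 e2
    refine le_of_sub_nonneg ((sub_nonneg.2 key).trans (le_of_eq ?_))
    have hφx : lift φ x = φ (proj x) := rfl
    rw [hφx] at e5
    linear_combination e5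
  have hPp : TorusPeriodic fun x => -p (lift m x) := hmp.comp fun t => -p t
  have hPc : Continuous fun x => -p (lift m x) := (hp.continuous_comp hm.continuous hmpos).neg
  have hDp : TorusPeriodic fun x => laplacianPow k (lift m) x ^ 2 :=
    (hmp.laplacianPow k).comp (· ^ 2)
  have hDc : Continuous fun x => laplacianPow k (lift m) x ^ 2 :=
    (ContDiff.laplacianPow hm k).continuous.pow 2
  have hint : (1 - ε) * torusAvg (fun x => -p (lift m x)) +
      ε * torusAvg (fun x => laplacianPow k (lift m) x ^ 2) ≤ C := by
    have i1 := (hPp.integrable hPc).const_mul (1 - ε)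
    have i2 := (hDp.integrable hDc).const_mul ε
    have i3 := hZ.periodic.integrable hZ.continuous
    have h1 := integral_mono ((i1.add i2).add i3) (integrable_const C) fun x => hpoint (rep x)
    have h2 := integral_add (i1.add i2) i3
    have h3 := integral_add i1 i2
    simp only [Pi.add_apply] at h1 h2 h3
    rw [h2, h3, integral_const_mul, integral_const_mul] at h1
    have h4 : ∫ x, R (rep x) ∂torusMeasure d = 0 := hZ.avg_eq_zero
    simpa [torusAvg, h4] using h1
  have hP0 : 0 ≤ torusAvg (fun x => -p (lift m x)) :=
    integral_nonneg fun x => neg_nonneg.2 (hp.nonpos _ (hmpos _))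
  have hD0 : 0 ≤ torusAvg (fun x => laplacianPow k (lift m) x ^ 2) :=
    integral_nonneg fun x => sq_nonneg _
  constructor <;> rw [le_div_iff₀ (by positivity)]
  · nlinarith [mul_nonneg he0.le hD0, mul_nonneg he1.le hP0]
  · nlinarith [mul_nonneg he1.le hP0, mul_nonneg he0.le hD0]

end Energy

/-! ### From the penalty bound to a pointwise lower bound. -/

section LowerBound

/-- Balls of the sup distance are products of arcs; `2 * r ≤ 1` keeps an arc from wrapping around
the circle. -/
lemma torusMeasure_real_closedBall (x : Torus d) {r : ℝ} (hr : 0 ≤ r) (hr' : 2 * r ≤ 1) :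
    (torusMeasure d).real (Metric.closedBall x r) = (2 * r) ^ d := by
  have h1 : ∀ y : UnitAddCircle, AddCircle.haarAddCircle (Metric.closedBall y r) =
      ENNReal.ofReal (2 * r) := fun y => by
    have := AddCircle.volume_closedBall (T := 1) (x := y) r
    rwa [AddCircle.volume_eq_smul_haarAddCircle, ENNReal.ofReal_one, one_smul,
      min_eq_right hr'] at this
  have h2 : torusMeasure d (Metric.closedBall x r) =
      ∏ i, AddCircle.haarAddCircle (Metric.closedBall (x i) r) := Measure.pi_closedBall _ _ hr
  simp only [Measure.real, h2, h1, Finset.prod_const, Finset.card_univ, Fintype.card_fin,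
    ENNReal.toReal_pow, ENNReal.toReal_ofReal (mul_nonneg zero_le_two hr)]

/-- A positive function which is Lipschitz and has a penalty with bounded mean is bounded below. -/
lemma le_of_penalty_bound {ε : ℝ} {p : ℝ → ℝ} (hε : ε ∈ Ioo (0 : ℝ) 1) (hp : IsPenalty d ε p)
    {f : Torus d → ℝ} (hf : Continuous f) (hpos : ∀ x, 0 < f x) {L K : ℝ} (hL : 1 ≤ L)
    (hK : 0 < K) (hLip : ∀ x y, |f x - f y| ≤ L * dist x y)
    (hbound : ∫ x, -p (f x) ∂torusMeasure d ≤ K) (x : Torus d) :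
    min (ε / 4) (1 / (2 * K * L ^ d)) ≤ f x := by
  by_contra! hlt
  obtain ⟨h1, h2⟩ := lt_min_iff.1 hlt
  set η := f x
  have hη : 0 < η := hpos x
  have hL0 : 0 < L := by linarith
  have hr' : 2 * (η / L) ≤ 1 := by
    have := div_le_self hη.le hL
    linarith [hε.2]
  have hc : Continuous fun y => -p (f y) := (hp.smooth.continuousOn.comp_continuous hf hpos).neg
  -- On this ball `f ≤ 2η`, and `η < ε / 4` puts these values in `(0, ε / 2]`, where `p` is
  -- explicit.
  have hpt : ∀ y, (Metric.closedBall x (η / L)).indicator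
      (fun _ => 1 / (2 * η) ^ (d + 1)) y ≤ -p (f y) := by
    intro y
    refine indicator_apply_le' (fun hy => ?_) fun _ => neg_nonneg.2 (hp.nonpos _ (hpos y))
    have h3 : f y ≤ 2 * η := by
      have h4 := (le_abs_self _).trans (hLip y x)
      have h5 : L * dist y x ≤ η := by
        rw [mul_comm]; exact (le_div_iff₀ hL0).1 (Metric.mem_closedBall.1 hy)
      have : f x = η := rfl
      linarith
    rw [hp.eq_near_zero _ (hpos y) (by linarith), neg_neg]
    have := hpos y
    gcongr
  have h6 := integral_mono ((integrable_const (1 / (2 * η) ^ (d + 1))).indicator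
    Metric.isClosed_closedBall.measurableSet) (integrable_of_continuous hc) hpt
  rw [integral_indicator_const _ Metric.isClosed_closedBall.measurableSet,
    torusMeasure_real_closedBall x (by positivity) hr', smul_eq_mul] at h6
  -- The exponent `d + 1` exceeds the dimension by one, so a factor `1 / η` survives.
  have h7 : (2 * (η / L)) ^ d * (1 / (2 * η) ^ (d + 1)) = 1 / (2 * η * L ^ d) := by
    rw [← mul_div_assoc 2 η L, div_pow, pow_succ]
    field_simp
  rw [h7] at h6
  have h8 : 1 ≤ K * (2 * η * L ^ d) := (div_le_iff₀ (by positivity)).1 (h6.trans hbound)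
  rw [lt_div_iff₀ (by positivity)] at h2
  nlinarith

end LowerBound

end MFG

end

theorem lemma4p13 (d k : ℕ) (hd : 1 ≤ d) (hk : (d : ℝ) / 2 + 3 < 2 * (k : ℝ))
    (H : MFG.E d → ℝ) (g : ℝ → ℝ) (V φ : MFG.Torus d → ℝ)
    (hH_smooth : ContDiff ℝ 2 H) (hH_convex : ConvexOn ℝ Set.univ H)
    (hg_nonneg : ∀ t, 0 ≤ t → 0 ≤ g t)
    (hg_cont : ContinuousOn g (Set.Ici 0)) (hg_mono : MonotoneOn g (Set.Ici 0))
    (hφ_cont : Continuous φ) (hφ_pos : ∀ x, 0 < φ x) (hφ_int : ∫ x, φ x = 1)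
    (α : ℝ) (hα : 1 < α)
    (hH_lagrangian : ∃ C : ℝ, 0 < C ∧ ∀ q : MFG.E d,
      1 / C * ‖q‖ ^ α - C ≤ -H q + inner ℝ (gradient H q) q)
    (hH_growth : ∃ C : ℝ, 0 < C ∧ ∀ q : MFG.E d, 1 / C * ‖q‖ ^ α - C ≤ H q)
    (hg_growth : ∀ δ : ℝ, δ ∈ Set.Ioo (0 : ℝ) 1 → ∃ C : ℝ, 0 < C ∧
      ∀ m : MFG.Torus d → ℝ, Integrable m → (∀ᵐ x, 0 ≤ m x) →
        (∫⁻ x, ENNReal.ofReal (m x)) + (∫⁻ x, ENNReal.ofReal (g (m x))) ≤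
          ENNReal.ofReal δ * (∫⁻ x, ENNReal.ofReal (m x * g (m x))) + ENNReal.ofReal C)
    (ε : ℝ) (hε : ε ∈ Set.Ioo (0 : ℝ) 1) (p : ℝ → ℝ) (hp : MFG.IsPenalty d ε p) :
    ∃ c : ℝ, 0 < c ∧ ∀ lam ∈ MFG.pathSet k H g V φ ε p, ∀ m u : MFG.Torus d → ℝ,
      MFG.IsSmoothSolution k H g V φ ε p lam m u → ∀ x, c ≤ m x := by
  have hk' : d + 2 < 4 * k := by
    have : ((d + 2 : ℕ) : ℝ) < ((4 * k : ℕ) : ℝ) := by push_cast; linarith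
    exact_mod_cast this
  have hL : ∃ C : ℝ, 0 < C ∧ ∀ q : MFG.E d, -C ≤ -H q + inner ℝ (gradient H q) q := by
    obtain ⟨C, hC, h⟩ := hH_lagrangian
    refine ⟨C, hC, fun q => le_trans ?_ (h q)⟩
    have : 0 ≤ 1 / C * ‖q‖ ^ α := by positivity
    linarith
  have hB : ∃ C : ℝ, 0 < C ∧ ∀ q : MFG.E d, -C ≤ H q := by
    obtain ⟨C, hC, h⟩ := hH_growth
    refine ⟨C, hC, fun q => le_trans ?_ (h q)⟩
    have : 0 ≤ 1 / C * ‖q‖ ^ α := by positivity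
    linarith
  obtain ⟨K, hK, hbound⟩ := MFG.exists_energy_bound (k := k) (V := V) (by omega) hH_smooth
    hg_nonneg hg_cont hg_mono hφ_cont hφ_pos hL hB hε hp
  obtain ⟨S, hS⟩ := MFG.exists_dist_le_of_laplacianPow hk'
  -- The maximum with `1` makes `η / L ≤ η`, so the ball used in `le_of_penalty_bound` is small
  -- enough.
  set L := max 1 (Real.pi * d * (K + S))
  have hL1 : 1 ≤ L := le_max_left _ _
  have hε0 := hε.1
  refine ⟨min (ε / 4) (1 / (2 * K * L ^ d)), by positivity, fun lam hlam m u h => ?_⟩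
  obtain ⟨h1, h2⟩ := hbound lam hlam.1 m u h
  have hm : Continuous m := by
    simpa using (MFG.torusPeriodic_lift m).continuous_comp_rep h.smooth_m.continuous
  refine MFG.le_of_penalty_bound hε hp hm h.pos hL1 hK (fun x y => ?_)
    (by simpa [MFG.torusAvg] using h1)
  refine (hS m h.smooth_m x y).trans (mul_le_mul_of_nonneg_right ?_ dist_nonneg)
  refine le_trans ?_ (le_max_right _ _)
  gcongr
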